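/- A Deza graph with parameters $(n,k,b,a)$, $b\ge a$, is a $k$-regular graph on $n$ vertices, neither complete nor edgeless, in which any two distinct vertices have $b$ or $a$ common neighbours. Its children $G_A$ and $G_B$ are the graphs on the same vertex set in which two distinct vertices are adjacent if and only if they have $a$, respectively $b$, common neighbours in $G$ (if $b=a$, then $G_A$ is complete and $G_B$ is edgeless). $G$ is a strongly Deza graph if both children are strongly regular (complete and edgeless graphs are not counted as strongly regular). Theorem. For every prime power $q>2$ there exists a strongly Deza graph $G$ with parameters $(q^2(q^2-q+1),\,q(q-1),\,1,\,0)$ and spectrum (exponents denote multiplicities) \[ \{\,(q(q-1))^{1},\ q^{(q^4-q)/2-q^3+q^2},\ (-1)^{q^3},\ (-q)^{(q^4-q)/2-q^3+q-1}\,\}. \] The graph $G$ can be taken to be the unitary nonisotropics graph, whose vertices are the nonisotropic points of the projective plane over the field $\mathbb F_{q^2}$ with respect to the Hermitian form $\sum_{i=1}^{3}x_iy_i^{q}$, two of them being adjacent if and only if they are orthogonal. It is distance-regular of diameter $3$, its child $G_A$ (with $a=0$) is the distance-$3$ graph of $G$, and $G_A$ is strongly regular with parameters \[ \bigl(q^2(q^2-q+1),\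 (q-1)(q+1)^2,\ 2q^2-2,\ (q+1)^2\bigr). \] -/

import Mathlib

/-! ### Strongly regular graphs, Deza graphs, and their children -/

namespace SimpleGraph

variable {V : Type*}

open scoped Classical in
/-- `G` is strongly regular with parameters `(n, k, l, m)`. As usual, the complete graph and the
edgeless graph do not count as strongly regular. -/
def IsStronglyRegularWith [Fintype V] (G : SimpleGraph V) (n k l m : ℕ) : Prop :=
  G.IsSRGWith n k l m ∧ G ≠ ⊥ ∧ G ≠ ⊤

/-- `G` is strongly regular (for some parameters). -/
def IsStronglyRegular [Fintype V] (G : SimpleGraph V) : Prop :=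
  ∃ n k l m : ℕ, G.IsStronglyRegularWith n k l m

open scoped Classical in
/-- `G` is a Deza graph with parameters `(n, k, b, a)`: it is `k`-regular of order `n`, `b ≥ a`, any
two distinct vertices have `b` or `a` common neighbours, and `G` is neither complete nor
edgeless. -/
structure IsDeza [Fintype V] (G : SimpleGraph V) (n k b a : ℕ) : Prop where
  card : Fintype.card V = n
  regular : G.IsRegularOfDegree k
  le : a ≤ b
  common : ∀ x y : V, x ≠ y →
    (G.commonNeighbors x y).ncard = b ∨ (G.commonNeighbors x y).ncard = a
  ne_bot : G ≠ ⊥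
  ne_top : G ≠ ⊤

/-- The child `G_A`: distinct vertices are adjacent when they have `a` common neighbours in `G`. -/
def childA (G : SimpleGraph V) (a : ℕ) : SimpleGraph V where
  Adj x y := x ≠ y ∧ (G.commonNeighbors x y).ncard = a
  symm := ⟨fun x y h => ⟨h.1.symm, by rw [G.commonNeighbors_symm]; exact h.2⟩⟩
  loopless := ⟨fun _ h => h.1 rfl⟩

/-- The child `G_B`: distinct vertices are adjacent when they have `b` common neighbours in `G`.
If `b = a`, then by convention `G_A` is complete and `G_B` is edgeless. -/
def childB (G : SimpleGraph V) (b a : ℕ) : SimpleGraph V where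
  Adj x y := x ≠ y ∧ b ≠ a ∧ (G.commonNeighbors x y).ncard = b
  symm := ⟨fun x y h => ⟨h.1.symm, h.2.1, by rw [G.commonNeighbors_symm]; exact h.2.2⟩⟩
  loopless := ⟨fun _ h => h.1 rfl⟩

/-- A strongly Deza graph is a Deza graph whose children are strongly regular. -/
structure IsStronglyDeza [Fintype V] (G : SimpleGraph V) (n k b a : ℕ) : Prop where
  deza : G.IsDeza n k b a
  srgA : (G.childA a).IsStronglyRegular
  srgB : (G.childB b a).IsStronglyRegular

open scoped Classical in
/-- The spectrum of `G`: the multiset of eigenvalues of its (real symmetric) adjacency matrix,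
counted with multiplicity. -/
noncomputable def adjSpectrum [Fintype V] (G : SimpleGraph V) : Multiset ℝ :=
  (G.adjMatrix ℝ).charpoly.roots

/-- The distance-`i` graph of `G`: distinct vertices are adjacent when they are at distance `i`
in `G`. -/
def distanceGraph (G : SimpleGraph V) (i : ℕ) : SimpleGraph V where
  Adj x y := x ≠ y ∧ G.edist x y = i
  symm := ⟨fun x y h => ⟨h.1.symm, by rw [G.edist_comm]; exact h.2⟩⟩
  loopless := ⟨fun _ h => h.1 rfl⟩

/-- `G` is distance-regular: it is connected and, for all `i` up to the diameter and all `x`, `y` at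
distance `i`, the numbers of neighbours of `y` at distance `i + 1`, `i`, `i - 1` from `x` are
numbers `b i`, `a i`, `c i` that depend only on `i`. -/
def IsDistanceRegular (G : SimpleGraph V) : Prop :=
  G.Connected ∧ ∃ a b c : ℕ → ℕ, ∀ x y : V,
    {z | G.Adj y z ∧ G.dist x z = G.dist x y + 1}.ncard = b (G.dist x y) ∧
    {z | G.Adj y z ∧ G.dist x z = G.dist x y}.ncard = a (G.dist x y) ∧
    {z | G.Adj y z ∧ G.dist x z + 1 = G.dist x y}.ncard = c (G.dist x y)

end SimpleGraph

/-! ### The unitary nonisotropics graph -/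

open scoped LinearAlgebra.Projectivization

section Unitary

variable {K : Type*} [Field K]

/-- The standard Hermitian form `∑ xᵢ yᵢ^q` on `K³`, where `K` is a field with `q²` elements (so
that `t ↦ t^q` is the involutory automorphism of `K`). -/
def hermForm (q : ℕ) (x y : Fin 3 → K) : K := ∑ i, x i * y i ^ q

theorem hermForm_pow [Fintype K] {q : ℕ} (hK : Fintype.card K = q ^ 2) (x y : Fin 3 → K) :
    hermForm q x y ^ q = hermForm q y x := by
  obtain ⟨p, hp⟩ := CharP.exists K
  obtain ⟨n, hpp, hn⟩ := FiniteField.card K p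
  have : Fact p.Prime := ⟨hpp⟩
  obtain ⟨m, -, rfl⟩ := (Nat.dvd_prime_pow hpp).1
    (show q ∣ p ^ (n : ℕ) by rw [← hn, hK]; exact Dvd.intro_left (q ^ 1) (by ring))
  unfold hermForm
  rw [sum_pow_char_pow]
  refine Finset.sum_congr rfl fun i _ => ?_
  rw [mul_pow, ← pow_mul, ← sq, ← hK, FiniteField.pow_card, mul_comm]

theorem hermForm_eq_zero_comm [Fintype K] {q : ℕ} (hK : Fintype.card K = q ^ 2)
    {x y : Fin 3 → K} (h : hermForm q x y = 0) : hermForm q y x = 0 := by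
  have hq : q ≠ 0 := by
    rintro rfl
    simp at hK
  rw [← hermForm_pow hK, h, zero_pow hq]

/-- The nonisotropic points of the projective plane over `K`. (Whether a point is isotropic, and
whether two points are orthogonal, does not depend on the vectors that represent them.) -/
abbrev NonisotropicPoint (q : ℕ) (K : Type*) [Field K] : Type _ :=
  {P : ℙ K (Fin 3 → K) // hermForm q P.rep P.rep ≠ 0}

/-- The unitary nonisotropics graph over the field `K` with `q²` elements: the vertices are the
nonisotropic points of the projective plane over `K`, adjacent when they are orthogonal. -/
def unitaryNonisotropicsGraph [Fintype K] (q : ℕ) (hK : Fintype.card K = q ^ 2) :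
    SimpleGraph (NonisotropicPoint q K) where
  Adj P Q := hermForm q P.1.rep Q.1.rep = 0
  symm := ⟨fun _ _ h => hermForm_eq_zero_comm hK h⟩
  loopless := ⟨fun P h => P.2 h⟩

end Unitary

open Matrix

/-! For distinct points `P`, `Q` of the plane, exactly one point `R` is orthogonal to both: the pole
of the line `PQ`. By the Binet–Cauchy identity the norm of `R` is the Gram determinant of `P` and
`Q`, so this determinant decides whether `R` is isotropic. If two nonisotropic points have an
isotropic pole, their polar lines meet in a point of the Hermitian curve and they have no common
neighbour; otherwise they have exactly one common neighbour and their polar lines share no isotropic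
point. Hence `G` is a Deza graph, and its child with `a = 0` is the block graph of the unital, a
2-(q³+1, q+1, 1) design.

The rest uses only the combinatorial axioms `IsPolarUnital`. Let A, C, N, J be the matrices of `G`,
of the child, of the incidence relation, and the all-ones matrix. The axioms say A² = (q²-q-1)I + J
- C, NNᵀ = (q+1)I + C and AN = J - N; counting gives NᵀN = (q²-1)I + J. Consequently C² and AC lie
in the span of I, A, C, J. The first yields strong regularity of the child. The second
(`adjM_mul_childM`) yields diameter 3 for q > 2, distance-regularity, and the fact that (A+1)(A²-q²)
is a multiple of J, so that only four eigenvalues are possible; the traces of A⁰, …, A³ fix their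
multiplicities. -/

/-- The incidences between the vertices of `G` and the points of a unital of order `q` that the
polarity of a projective plane of order `q²` gives rise to: `I` makes the vertices the blocks of a
`2-(q³ + 1, q + 1, 1)` design, two vertices are adjacent when they are conjugate. -/
structure IsPolarUnital {V U : Type*} (G : SimpleGraph V) (I : V → U → Prop) (q : ℕ) : Prop where
  block_card : ∀ x, {u | I x u}.ncard = q + 1
  degree : ∀ x, {y | G.Adj x y}.ncard + q = q ^ 2
  join : ∀ u v, u ≠ v → ∃! x, I x u ∧ I x v
  meet_or_common : ∀ x y, x ≠ y →
    (∃! u, I x u ∧ I y u) ∧ (∀ z, ¬(G.Adj x z ∧ G.Adj y z)) ∨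
    (∃! z, G.Adj x z ∧ G.Adj y z) ∧ ∀ u, ¬(I x u ∧ I y u)
  adj_disjoint : ∀ x y, G.Adj x y → ∀ u, ¬(I x u ∧ I y u)
  antiflag : ∀ x u, ¬I x u → ∃! y, G.Adj x y ∧ I y u

/-! ### Zero-one matrices and counting. -/

/-- The all-ones matrix. -/
def onesMatrix (m n : Type*) : Matrix m n ℝ := Matrix.of fun _ _ => 1

@[simp] theorem onesMatrix_apply {m n : Type*} (i : m) (j : n) : onesMatrix m n i j = 1 := rfl

@[simp] theorem transpose_onesMatrix (m n : Type*) : (onesMatrix m n)ᵀ = onesMatrix n m := rfl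

theorem ncard_eq_one_of_existsUnique {α : Type*} {p : α → Prop} (h : ∃! a, p a) :
    {a | p a}.ncard = 1 := by
  obtain ⟨a, ha, hu⟩ := h
  exact Set.ncard_eq_one.2 ⟨a, Set.ext fun b => ⟨hu b, fun hb => hb ▸ ha⟩⟩

theorem ncard_eq_zero_of_forall_not {α : Type*} {p : α → Prop} (h : ∀ a, ¬p a) :
    {a | p a}.ncard = 0 := by
  simp [h]

open scoped Classical in
theorem sum_ite_mul_ite {α : Type*} [Fintype α] (p r : α → Prop) :
    ∑ a, (if p a then (1 : ℝ) else 0) * (if r a then 1 else 0) = ({a | p a ∧ r a}.ncard : ℝ) := by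
  simp [← ite_and, Set.ncard_eq_toFinset_card', Finset.sum_boole, and_comm]

open scoped Classical in
theorem sum_ite_eq_ncard {α : Type*} [Fintype α] (p : α → Prop) :
    ∑ a, (if p a then (1 : ℝ) else 0) = ({a | p a}.ncard : ℝ) := by
  simp [Set.ncard_eq_toFinset_card', Finset.sum_boole]

/-! ### Matrix identities of a polar unital. -/

namespace IsPolarUnital

variable {V U : Type*} [Fintype V] [Fintype U] {G : SimpleGraph V} {I : V → U → Prop} {q : ℕ}

set_option linter.unusedSectionVars false

open scoped Classical

/-- The adjacency matrix of `G`, with classical decidability. -/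
noncomputable def adjM (G : SimpleGraph V) : Matrix V V ℝ := G.adjMatrix ℝ

theorem adjM_apply (G : SimpleGraph V) (x y : V) : adjM G x y = if G.Adj x y then 1 else 0 := by
  simp [adjM, SimpleGraph.adjMatrix_apply]

/-- The incidence matrix of `I`. -/
noncomputable def incM (I : V → U → Prop) : Matrix V U ℝ := Matrix.of fun x u => if I x u then 1 else 0

theorem incM_apply (x : V) (u : U) : incM I x u = if I x u then 1 else 0 := rfl

theorem transpose_adjM (G : SimpleGraph V) : (adjM G)ᵀ = adjM G := G.transpose_adjMatrix

theorem adjM_mul_adjM_apply (G H : SimpleGraph V) (x y : V) :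
    (adjM G * adjM H) x y = ({z | G.Adj x z ∧ H.Adj y z}.ncard : ℝ) := by
  simp_rw [Matrix.mul_apply, adjM_apply, H.adj_comm _ y, sum_ite_mul_ite]

theorem childA_adj_iff {x y : V} :
    (G.childA 0).Adj x y ↔ x ≠ y ∧ ∀ z, ¬(G.Adj x z ∧ G.Adj y z) := by
  change _ ∧ _ ↔ _
  rw [Set.ncard_eq_zero]
  simp [SimpleGraph.commonNeighbors, Set.eq_empty_iff_forall_notMem]

theorem childA_adj_iff_exists (h : IsPolarUnital G I q) {x y : V} :
    (G.childA 0).Adj x y ↔ x ≠ y ∧ ∃ u, I x u ∧ I y u := by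
  rw [childA_adj_iff]
  refine and_congr_right fun hxy => ?_
  rcases h.meet_or_common x y hxy with ⟨h1, h2⟩ | ⟨h1, h2⟩
  · exact ⟨fun _ => h1.exists, fun _ => h2⟩
  · exact ⟨fun h3 => absurd h1.exists.choose_spec (h3 _), fun ⟨u, hu⟩ => absurd hu (h2 u)⟩

/-- Every edge lies in a triangle: adjacent vertices have disjoint blocks, which by the dichotomy
forces a common neighbour. -/
theorem not_childA_of_adj (h : IsPolarUnital G I q) {x y : V} (hxy : G.Adj x y) :
    ¬(G.childA 0).Adj x y := by
  rw [h.childA_adj_iff_exists]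
  rintro ⟨-, u, hu⟩
  exact h.adj_disjoint x y hxy u hu

theorem degree_real (h : IsPolarUnital G I q) (x : V) :
    ({y | G.Adj x y}.ncard : ℝ) = (q : ℝ) ^ 2 - q := by
  rw [eq_sub_iff_add_eq]
  exact_mod_cast h.degree x

theorem adjM_mul_self (h : IsPolarUnital G I q) :
    adjM G * adjM G = ((q : ℝ) ^ 2 - q - 1) • 1 + onesMatrix V V - adjM (G.childA 0) := by
  ext x y
  rw [adjM_mul_adjM_apply]
  simp only [Matrix.sub_apply, Matrix.add_apply, Matrix.smul_apply, onesMatrix_apply, adjM_apply]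
  rcases eq_or_ne x y with rfl | hxy
  · simp [h.degree_real]
  · rw [Matrix.one_apply_ne hxy, childA_adj_iff]
    rcases h.meet_or_common x y hxy with ⟨h1, h2⟩ | ⟨h1, h2⟩
    · rw [ncard_eq_zero_of_forall_not h2, if_pos ⟨hxy, h2⟩]; simp
    · rw [ncard_eq_one_of_existsUnique h1, if_neg fun h3 => h3.2 _ h1.exists.choose_spec]; simp

theorem incM_mul_transpose (h : IsPolarUnital G I q) :
    incM I * (incM I)ᵀ = ((q : ℝ) + 1) • 1 + adjM (G.childA 0) := by
  ext x y
  simp_rw [Matrix.mul_apply, Matrix.transpose_apply, incM_apply, sum_ite_mul_ite]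
  simp only [Matrix.add_apply, Matrix.smul_apply, adjM_apply]
  rcases eq_or_ne x y with rfl | hxy
  · simp [h.block_card]
  · rw [Matrix.one_apply_ne hxy, h.childA_adj_iff_exists]
    rcases h.meet_or_common x y hxy with ⟨h1, h2⟩ | ⟨h1, h2⟩
    · rw [ncard_eq_one_of_existsUnique h1, if_pos ⟨hxy, h1.exists⟩]; simp
    · rw [ncard_eq_zero_of_forall_not h2, if_neg fun h3 => h2 _ h3.2.choose_spec]; simp

/-- The (x, u) entry counts neighbours of x whose block contains u: none if u lies on x
(disjointness), exactly one otherwise (the antiflag axiom). -/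
theorem adjM_mul_incM (h : IsPolarUnital G I q) :
    adjM G * incM I = onesMatrix V U - incM I := by
  ext x u
  simp_rw [Matrix.mul_apply, adjM_apply, incM_apply, sum_ite_mul_ite]
  simp only [Matrix.sub_apply, onesMatrix_apply, incM_apply]
  by_cases hxu : I x u
  · rw [ncard_eq_zero_of_forall_not fun y hy => h.adj_disjoint x y hy.1 u ⟨hxu, hy.2⟩]
    simp [hxu]
  · rw [ncard_eq_one_of_existsUnique (h.antiflag x u hxu)]
    simp [hxu]

theorem incM_mul_ones (h : IsPolarUnital G I q) (W : Type*) :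
    incM I * onesMatrix U W = ((q : ℝ) + 1) • onesMatrix V W := by
  ext x w
  simp_rw [Matrix.mul_apply, incM_apply, onesMatrix_apply, mul_one, sum_ite_eq_ncard, h.block_card]
  simp

theorem ones_mul_transpose_incM (h : IsPolarUnital G I q) (W : Type*) :
    onesMatrix W U * (incM I)ᵀ = ((q : ℝ) + 1) • onesMatrix W V := by
  simpa using congrArg transpose (h.incM_mul_ones W)

theorem adjM_mul_ones (h : IsPolarUnital G I q) (W : Type*) :
    adjM G * onesMatrix V W = ((q : ℝ) ^ 2 - q) • onesMatrix V W := by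
  ext x w
  simp_rw [Matrix.mul_apply, adjM_apply, onesMatrix_apply, mul_one, sum_ite_eq_ncard, h.degree_real]
  simp

theorem ones_mul_ones (m n W : Type*) [Fintype n] :
    onesMatrix m n * onesMatrix n W = (Fintype.card n : ℝ) • onesMatrix m W := by
  ext
  simp [Matrix.mul_apply]

/-- Row sums of AN = J - N, taken in two ways, give (q+1)(q²-q) = |U| - (q+1). -/
theorem card_points [Nonempty V] (h : IsPolarUnital G I q) :
    (Fintype.card U : ℝ) = (q : ℝ) ^ 3 + 1 := by
  have h1 : adjM G * incM I * onesMatrix U U = adjM G * (incM I * onesMatrix U U) :=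
    Matrix.mul_assoc _ _ _
  rw [h.adjM_mul_incM, Matrix.sub_mul, h.incM_mul_ones, Matrix.mul_smul, h.adjM_mul_ones,
    ones_mul_ones] at h1
  obtain ⟨x⟩ := ‹Nonempty V›
  obtain ⟨u, hu⟩ : {u | I x u}.Nonempty := by
    rw [← Set.ncard_pos, h.block_card]; omega
  have h2 := congrFun (congrFun h1 x) u
  simp at h2
  linarith

/-- If r blocks pass through u, counting pairs (x, v) with u and v on x gives (q+1)r = r + q³. -/
theorem replication [Nonempty V] (h : IsPolarUnital G I q) (hq : q ≠ 0) (u : U) :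
    ({x | I x u}.ncard : ℝ) = (q : ℝ) ^ 2 := by
  have h1 : (incM I)ᵀ * incM I * onesMatrix U U = (incM I)ᵀ * (incM I * onesMatrix U U) :=
    Matrix.mul_assoc _ _ _
  rw [h.incM_mul_ones, Matrix.mul_smul] at h1
  -- The diagonal entry is written as an excess r - 1 over the constant 1, so that `h5` can split
  -- the row sum.
  have h2 : ∀ v, ((incM I)ᵀ * incM I) u v =
      if u = v then ({x | I x u}.ncard : ℝ) - 1 + 1 else 1 := fun v => by
    simp_rw [Matrix.mul_apply, Matrix.transpose_apply, incM_apply, sum_ite_mul_ite]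
    split_ifs with huv
    · simp [huv]
    · simp [ncard_eq_one_of_existsUnique (h.join u v huv)]
  have h3 := congrFun (congrFun h1 u) u
  simp_rw [Matrix.mul_apply (N := onesMatrix U U), h2] at h3
  have h4 : ((incM I)ᵀ * onesMatrix V U) u u = ({x | I x u}.ncard : ℝ) := by
    simp_rw [Matrix.mul_apply, Matrix.transpose_apply, incM_apply, onesMatrix_apply, mul_one,
      sum_ite_eq_ncard]
  rw [Matrix.smul_apply, h4, smul_eq_mul] at h3
  have h5 : ∀ v, (if u = v then ({x | I x u}.ncard : ℝ) - 1 + 1 else 1) =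
      (if u = v then ({x | I x u}.ncard : ℝ) - 1 else 0) + 1 := fun v => by split_ifs <;> simp
  simp_rw [h5, onesMatrix_apply, mul_one, Finset.sum_add_distrib] at h3
  simp [h.card_points] at h3
  have hq' : (q : ℝ) ≠ 0 := by exact_mod_cast hq
  apply mul_left_cancel₀ hq'
  linarith

theorem transpose_mul_incM [Nonempty V] (h : IsPolarUnital G I q) (hq : q ≠ 0) :
    (incM I)ᵀ * incM I = ((q : ℝ) ^ 2 - 1) • 1 + onesMatrix U U := by
  ext u v
  simp_rw [Matrix.mul_apply, Matrix.transpose_apply, incM_apply, sum_ite_mul_ite]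
  simp only [Matrix.add_apply, Matrix.smul_apply, onesMatrix_apply]
  rcases eq_or_ne u v with rfl | huv
  · simp [h.replication hq]
  · rw [Matrix.one_apply_ne huv, ncard_eq_one_of_existsUnique (h.join u v huv)]; simp

theorem transpose_incM_mul_ones [Nonempty V] (h : IsPolarUnital G I q) (hq : q ≠ 0) (W : Type*) :
    (incM I)ᵀ * onesMatrix V W = ((q : ℝ) ^ 2) • onesMatrix U W := by
  ext u w
  simp_rw [Matrix.mul_apply, Matrix.transpose_apply, incM_apply, onesMatrix_apply, mul_one,
    sum_ite_eq_ncard, h.replication hq]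
  simp

/-- Double counting of flags: (q+1)|V| = q²(q³+1). -/
theorem card_vertices_real [Nonempty V] (h : IsPolarUnital G I q) (hq : q ≠ 0) :
    (Fintype.card V : ℝ) = (q : ℝ) ^ 2 * ((q : ℝ) ^ 2 - q + 1) := by
  have h1 : onesMatrix U V * (incM I * onesMatrix U U) =
      (onesMatrix U V * incM I) * onesMatrix U U := (Matrix.mul_assoc _ _ _).symm
  have h2 := congrArg transpose (h.transpose_incM_mul_ones hq U)
  simp only [transpose_mul, transpose_transpose, transpose_smul, transpose_onesMatrix] at h2
  rw [h2, h.incM_mul_ones, Matrix.mul_smul, Matrix.smul_mul, ones_mul_ones, ones_mul_ones,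
    h.card_points] at h1
  have : Nonempty U := by
    rw [← Fintype.card_pos_iff]
    have := h.card_points
    exact_mod_cast this ▸ (by positivity : (0 : ℝ) < (q : ℝ) ^ 3 + 1)
  obtain ⟨u⟩ := this
  have h3 := congrFun (congrFun h1 u) u
  simp at h3
  have hq' : (q : ℝ) + 1 ≠ 0 := by positivity
  apply mul_left_cancel₀ hq'
  linarith

theorem card_vertices [Nonempty V] (h : IsPolarUnital G I q) (hq : q ≠ 0) :
    Fintype.card V = q ^ 2 * (q ^ 2 - q + 1) := by
  have h1 := h.card_vertices_real hq
  have : q ≤ q ^ 2 := Nat.le_self_pow (by norm_num) q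
  rify
  rw [h1, Nat.cast_sub this]
  push_cast
  ring

/-- Evaluate N(NᵀN)Nᵀ = (NNᵀ)², with NNᵀ = (q+1)I + C. -/
theorem childM_mul_self [Nonempty V] (h : IsPolarUnital G I q) (hq : q ≠ 0) :
    adjM (G.childA 0) * adjM (G.childA 0) =
      ((q : ℝ) ^ 2 - 2 * q - 3) • adjM (G.childA 0) +
      (((q : ℝ) + 1) * ((q : ℝ) ^ 2 - q - 2)) • 1 + ((q : ℝ) + 1) ^ 2 • onesMatrix V V := by
  have h1 : incM I * (incM I)ᵀ * (incM I * (incM I)ᵀ) =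
      incM I * ((incM I)ᵀ * incM I) * (incM I)ᵀ := by simp only [Matrix.mul_assoc]
  rw [h.transpose_mul_incM hq, Matrix.mul_add, Matrix.mul_smul, Matrix.mul_one, Matrix.add_mul,
    Matrix.smul_mul, h.incM_mul_ones, Matrix.smul_mul, h.ones_mul_transpose_incM,
    h.incM_mul_transpose] at h1
  simp only [Matrix.add_mul, Matrix.mul_add, Matrix.smul_mul, Matrix.mul_smul, Matrix.one_mul,
    Matrix.mul_one] at h1
  -- With both identities in the form "= 0", the two left-hand sides agree by linear algebra alone.
  rw [← sub_eq_zero] at h1 ⊢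
  rw [← h1]
  module

/-- Associativity of A·N·Nᵀ, with AN = J - N. -/
theorem adjM_mul_childM (h : IsPolarUnital G I q) :
    adjM G * adjM (G.childA 0) =
      ((q : ℝ) + 1) • (onesMatrix V V - 1 - adjM G) - adjM (G.childA 0) := by
  have h1 : adjM G * (incM I * (incM I)ᵀ) = adjM G * incM I * (incM I)ᵀ :=
    (Matrix.mul_assoc _ _ _).symm
  rw [h.adjM_mul_incM, Matrix.sub_mul, h.ones_mul_transpose_incM, h.incM_mul_transpose,
    Matrix.mul_add, Matrix.mul_smul, Matrix.mul_one] at h1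
  rw [← sub_eq_zero] at h1 ⊢
  rw [← h1]
  module

end IsPolarUnital

/-! ### Strong regularity of the children. -/

theorem SimpleGraph.degree_eq_ncard {V : Type*} (G : SimpleGraph V) (x : V)
    [Fintype (G.neighborSet x)] : G.degree x = {y | G.Adj x y}.ncard := by
  rw [← G.card_neighborSet_eq_degree, ← Nat.card_eq_fintype_card]
  rfl

open scoped Classical in
theorem SimpleGraph.isSRGWith_of_ncard {V : Type*} [Fintype V] {G : SimpleGraph V} {n k l m : ℕ}
    (hn : Fintype.card V = n) (hk : ∀ x, {y | G.Adj x y}.ncard = k)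
    (hl : ∀ x y, G.Adj x y → {z | G.Adj x z ∧ G.Adj y z}.ncard = l)
    (hm : ∀ x y, x ≠ y → ¬G.Adj x y → {z | G.Adj x z ∧ G.Adj y z}.ncard = m) :
    G.IsSRGWith n k l m where
  card := hn
  regular x := by rw [G.degree_eq_ncard, hk]
  of_adj x y h := by
    rw [← hl x y h, ← Nat.card_eq_fintype_card]; rfl
  of_not_adj x y h h' := by
    rw [← hm x y h h', ← Nat.card_eq_fintype_card]; rfl

namespace IsPolarUnital

set_option linter.unusedSectionVars false

open scoped Classical

variable {V U : Type*} [Fintype V] [Fintype U] {G : SimpleGraph V} {I : V → U → Prop} {q : ℕ}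

theorem childA_ncard_real [Nonempty V] (h : IsPolarUnital G I q) (hq : q ≠ 0) (x : V) :
    ({y | (G.childA 0).Adj x y}.ncard : ℝ) = ((q : ℝ) - 1) * (q + 1) ^ 2 := by
  have h1 := congrFun (congrFun (h.childM_mul_self hq) x) x
  rw [adjM_mul_adjM_apply] at h1
  simp [adjM_apply] at h1
  rw [h1]
  ring

theorem childA_ncard [Nonempty V] (h : IsPolarUnital G I q) (hq : q ≠ 0) (x : V) :
    {y | (G.childA 0).Adj x y}.ncard = (q - 1) * (q + 1) ^ 2 := by
  have h1 := h.childA_ncard_real hq x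
  rify
  rw [h1, Nat.cast_sub (Nat.one_le_iff_ne_zero.2 hq)]
  push_cast
  ring

theorem childA_common_real [Nonempty V] (h : IsPolarUnital G I q) (hq : q ≠ 0) {x y : V}
    (hxy : x ≠ y) :
    ({z | (G.childA 0).Adj x z ∧ (G.childA 0).Adj y z}.ncard : ℝ) =
      ((q : ℝ) ^ 2 - 2 * q - 3) * adjM (G.childA 0) x y + ((q : ℝ) + 1) ^ 2 := by
  rw [← adjM_mul_adjM_apply, h.childM_mul_self hq]
  simp [Matrix.one_apply_ne hxy]

theorem exists_adj (h : IsPolarUnital G I q) (hq : 2 ≤ q) (x : V) : ∃ y, G.Adj x y := by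
  have h1 := h.degree x
  have : q < q ^ 2 := lt_self_pow₀ hq (by norm_num)
  exact (Set.ncard_pos (s := {y | G.Adj x y})).1 (by omega)

theorem exists_childA_adj [Nonempty V] (h : IsPolarUnital G I q) (hq : 2 ≤ q) (x : V) :
    ∃ y, (G.childA 0).Adj x y := by
  have h1 := h.childA_ncard (by omega) x
  refine (Set.ncard_pos (s := {y | (G.childA 0).Adj x y})).1 ?_
  rw [h1]
  exact Nat.mul_pos (by omega) (by positivity)

theorem childA_ne_bot [Nonempty V] (h : IsPolarUnital G I q) (hq : 2 ≤ q) : G.childA 0 ≠ ⊥ := by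
  intro h0
  obtain ⟨x⟩ := ‹Nonempty V›
  obtain ⟨y, hy⟩ := h.exists_childA_adj hq x
  rw [h0] at hy
  exact hy

theorem childA_ne_top [Nonempty V] (h : IsPolarUnital G I q) (hq : 2 ≤ q) : G.childA 0 ≠ ⊤ := by
  intro h0
  obtain ⟨x⟩ := ‹Nonempty V›
  obtain ⟨y, hy⟩ := h.exists_adj hq x
  have h1 := h.not_childA_of_adj hy
  rw [h0] at h1
  exact h1 hy.ne

theorem childA_isStronglyRegularWith [Nonempty V] (h : IsPolarUnital G I q) (hq : 2 ≤ q) :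
    (G.childA 0).IsStronglyRegularWith (q ^ 2 * (q ^ 2 - q + 1)) ((q - 1) * (q + 1) ^ 2)
      (2 * q ^ 2 - 2) ((q + 1) ^ 2) := by
  have hq0 : q ≠ 0 := by omega
  refine ⟨SimpleGraph.isSRGWith_of_ncard (h.card_vertices hq0) (h.childA_ncard hq0)
    (fun x y hxy => ?_) (fun x y hxy hxy' => ?_), h.childA_ne_bot hq, h.childA_ne_top hq⟩
  · have h1 := h.childA_common_real hq0 hxy.ne
    rw [adjM_apply, if_pos hxy] at h1
    have h2 : 2 ≤ 2 * q ^ 2 := by nlinarith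
    rify
    rw [h1, Nat.cast_sub h2]
    push_cast
    ring
  · have h1 := h.childA_common_real hq0 hxy
    rw [adjM_apply, if_neg hxy'] at h1
    rify
    rw [h1]
    ring

theorem ncard_commonNeighbors (h : IsPolarUnital G I q) {x y : V} (hxy : x ≠ y) :
    (G.commonNeighbors x y).ncard = 1 ∨ (G.commonNeighbors x y).ncard = 0 := by
  rcases h.meet_or_common x y hxy with ⟨-, h2⟩ | ⟨h1, -⟩
  · exact Or.inr (ncard_eq_zero_of_forall_not h2)
  · exact Or.inl (ncard_eq_one_of_existsUnique h1)

theorem childB_eq_compl (h : IsPolarUnital G I q) : G.childB 1 0 = (G.childA 0)ᶜ := by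
  ext x y
  rw [SimpleGraph.compl_adj]
  change _ ∧ _ ∧ _ ↔ _ ∧ ¬(_ ∧ _)
  refine and_congr_right fun hxy => ?_
  rcases h.ncard_commonNeighbors hxy with h1 | h1 <;> simp [h1, hxy]

theorem isDeza [Nonempty V] (h : IsPolarUnital G I q) (hq : 2 ≤ q) :
    G.IsDeza (q ^ 2 * (q ^ 2 - q + 1)) (q * (q - 1)) 1 0 where
  card := h.card_vertices (by omega)
  regular x := by
    rw [G.degree_eq_ncard, Nat.mul_sub, mul_one, ← sq, ← h.degree x, Nat.add_sub_cancel]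
  le := zero_le_one
  common _ _ hxy := h.ncard_commonNeighbors hxy
  ne_bot h0 := by
    obtain ⟨x⟩ := ‹Nonempty V›
    obtain ⟨y, hy⟩ := h.exists_adj hq x
    rw [h0] at hy
    exact hy
  ne_top h0 := by
    obtain ⟨x⟩ := ‹Nonempty V›
    obtain ⟨y, hy⟩ := h.exists_childA_adj hq x
    refine h.not_childA_of_adj (x := x) (y := y) ?_ hy
    rw [h0]
    exact hy.ne

theorem isStronglyDeza [Nonempty V] (h : IsPolarUnital G I q) (hq : 2 ≤ q) :
    G.IsStronglyDeza (q ^ 2 * (q ^ 2 - q + 1)) (q * (q - 1)) 1 0 where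
  deza := h.isDeza hq
  srgA := ⟨_, _, _, _, h.childA_isStronglyRegularWith hq⟩
  srgB := by
    rw [h.childB_eq_compl]
    have h1 := (h.childA_isStronglyRegularWith hq).1.compl
    refine ⟨_, _, _, _, by convert h1, ?_, ?_⟩
    · rw [Ne, compl_eq_bot]
      exact h.childA_ne_top hq
    · rw [Ne, compl_eq_top]
      exact h.childA_ne_bot hq

/-! ### Distances and distance-regularity. -/

theorem childA_iff_two_lt_edist (h : IsPolarUnital G I q) {x y : V} :
    (G.childA 0).Adj x y ↔ 2 < G.edist x y := by
  rw [SimpleGraph.two_lt_edist_iff]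
  constructor
  · intro hxy
    refine ⟨hxy.ne, fun h' => h.not_childA_of_adj h' hxy, ?_⟩
    exact Set.eq_empty_of_forall_notMem (childA_adj_iff.1 hxy).2
  · rintro ⟨h1, -, h2⟩
    exact childA_adj_iff.2 ⟨h1, fun z hz => Set.eq_empty_iff_forall_notMem.1 h2 z hz⟩

theorem edist_le_three (h : IsPolarUnital G I q) (hq : 2 < q) (x y : V) : G.edist x y ≤ 3 := by
  by_cases hxy : (G.childA 0).Adj x y
  · obtain ⟨z, hz, hxz⟩ : ∃ z, G.Adj y z ∧ ¬(G.childA 0).Adj x z := by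
      by_contra! h0
      -- If all neighbours of y were child-adjacent to x, the (y, x) entry of AC would be the
      -- valency q² - q, but the formula for AC gives (q+1) - 1 = q. Equality is impossible for q >
      -- 2.
      have h1 := congrFun (congrFun h.adjM_mul_childM y) x
      rw [adjM_mul_adjM_apply] at h1
      have h2 : {z | G.Adj y z ∧ (G.childA 0).Adj x z} = {z | G.Adj y z} := by
        ext z
        exact ⟨fun hz => hz.1, fun hz => ⟨hz, h0 z hz⟩⟩
      rw [h2, h.degree_real] at h1
      have h3 : ¬G.Adj y x := fun h' => h.not_childA_of_adj h' hxy.symm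
      simp [adjM_apply, hxy.symm, h3, Matrix.one_apply_ne hxy.ne'] at h1
      have hq' : (2 : ℝ) < q := by exact_mod_cast hq
      nlinarith
    rw [h.childA_iff_two_lt_edist, not_lt] at hxz
    calc G.edist x y ≤ G.edist x z + G.edist z y := G.edist_triangle
      _ ≤ 2 + 1 := add_le_add hxz (SimpleGraph.edist_eq_one_iff_adj.2 hz.symm).le
      _ = 3 := by norm_num
  · rw [h.childA_iff_two_lt_edist, not_lt] at hxy
    exact hxy.trans (by norm_num)

theorem childA_iff_edist (h : IsPolarUnital G I q) (hq : 2 < q) {x y : V} :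
    (G.childA 0).Adj x y ↔ G.edist x y = 3 := by
  rw [h.childA_iff_two_lt_edist]
  constructor
  · intro h1
    refine le_antisymm (h.edist_le_three hq x y) ?_
    have := Order.add_one_le_of_lt h1
    norm_num at this
    exact this
  · intro h1
    rw [h1]
    norm_num

theorem childA_eq_distanceGraph (h : IsPolarUnital G I q) (hq : 2 < q) :
    G.childA 0 = G.distanceGraph 3 := by
  ext x y
  change _ ↔ _ ∧ _
  rw [h.childA_iff_edist hq]
  refine ⟨fun h1 => ⟨?_, h1⟩, fun h1 => h1.2⟩
  rintro rfl
  simp at h1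

theorem ediam_le_three (h : IsPolarUnital G I q) (hq : 2 < q) : G.ediam ≤ 3 :=
  SimpleGraph.ediam_le_of_edist_le (h.edist_le_three hq)

theorem ediam_ne_top (h : IsPolarUnital G I q) (hq : 2 < q) : G.ediam ≠ ⊤ :=
  ne_top_of_le_ne_top (by simp) (h.ediam_le_three hq)

theorem connected [Nonempty V] (h : IsPolarUnital G I q) (hq : 2 < q) : G.Connected :=
  SimpleGraph.connected_of_ediam_ne_top (h.ediam_ne_top hq)

theorem diam_eq_three [Nonempty V] (h : IsPolarUnital G I q) (hq : 2 < q) : G.diam = 3 := by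
  obtain ⟨x⟩ := ‹Nonempty V›
  obtain ⟨y, hy⟩ := h.exists_childA_adj hq.le x
  have h1 : G.ediam = 3 := le_antisymm (h.ediam_le_three hq) <| by
    rw [← (h.childA_iff_edist hq).1 hy]
    exact SimpleGraph.edist_le_ediam
  simp [SimpleGraph.diam, h1]

theorem childA_iff_dist (h : IsPolarUnital G I q) (hq : 2 < q) {x y : V} :
    (G.childA 0).Adj x y ↔ G.dist x y = 3 := by
  rw [h.childA_iff_edist hq, SimpleGraph.dist, ENat.toNat_eq_iff (by norm_num)]
  rfl

theorem dist_le_three (h : IsPolarUnital G I q) (hq : 2 < q) (x y : V) : G.dist x y ≤ 3 :=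
  ENat.toNat_le_of_le_natCast (h.edist_le_three hq x y)

/-- The matrix of the relation of being at distance `i`. -/
noncomputable def distM (G : SimpleGraph V) (i : ℕ) : Matrix V V ℝ :=
  Matrix.of fun x y => if G.dist x y = i then 1 else 0

theorem distM_apply (i : ℕ) (x y : V) : distM G i x y = if G.dist x y = i then 1 else 0 := rfl

theorem distM_zero [Nonempty V] (h : IsPolarUnital G I q) (hq : 2 < q) : distM G 0 = 1 := by
  ext x y
  simp [distM_apply, Matrix.one_apply, (h.connected hq).dist_eq_zero_iff]

theorem distM_one : distM G 1 = adjM G := by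
  ext x y
  simp only [distM_apply, adjM_apply, SimpleGraph.dist_eq_one_iff_adj]

theorem distM_three (h : IsPolarUnital G I q) (hq : 2 < q) : distM G 3 = adjM (G.childA 0) := by
  ext x y
  simp [distM_apply, adjM_apply, h.childA_iff_dist hq]

theorem distM_two [Nonempty V] (h : IsPolarUnital G I q) (hq : 2 < q) :
    distM G 2 = onesMatrix V V - 1 - adjM G - adjM (G.childA 0) := by
  rw [← h.distM_zero hq, ← distM_one, ← h.distM_three hq]
  ext x y
  have h1 := h.dist_le_three hq x y
  simp only [Matrix.sub_apply, distM_apply, onesMatrix_apply]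
  interval_cases G.dist x y <;> norm_num

theorem distM_eq_zero (h : IsPolarUnital G I q) (hq : 2 < q) {i : ℕ} (hi : 3 < i) :
    distM G i = 0 := by
  ext x y
  have h1 := h.dist_le_three hq x y
  rw [distM_apply, if_neg (by omega)]
  rfl

/-- The span of J, I, A, C is stable under multiplication by A. Using J in place of the distance-2
matrix makes this visible from the identities for A² and AC. -/
theorem exists_adjM_mul_distM [Nonempty V] (h : IsPolarUnital G I q) (hq : 2 < q) (i : ℕ) :
    ∃ a b c d : ℝ, adjM G * distM G i =
      a • onesMatrix V V + b • distM G 0 + c • distM G 1 + d • distM G 3 := by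
  have h0 := h.adjM_mul_ones V
  have h1 := h.adjM_mul_self
  have h3 := h.adjM_mul_childM
  by_cases hi : 3 < i
  · exact ⟨0, 0, 0, 0, by simp [h.distM_eq_zero hq hi]⟩
  rw [h.distM_zero hq, distM_one, h.distM_three hq]
  obtain rfl | rfl | rfl | rfl : i = 0 ∨ i = 1 ∨ i = 2 ∨ i = 3 := by omega
  · exact ⟨0, 0, 1, 0, by simp [h.distM_zero hq]⟩
  · refine ⟨1, (q : ℝ) ^ 2 - q - 1, 0, -1, ?_⟩
    rw [distM_one, h1]
    module
  · refine ⟨(q : ℝ) ^ 2 - q - 1 - (q + 1), q + 1 - ((q : ℝ) ^ 2 - q - 1), q + 1 - 1, 2, ?_⟩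
    rw [h.distM_two hq, Matrix.mul_sub, Matrix.mul_sub, Matrix.mul_sub, h0, h1, h3, Matrix.mul_one]
    module
  · refine ⟨q + 1, -(q + 1), -(q + 1), -1, ?_⟩
    rw [h.distM_three hq, h3]
    module

theorem adjM_mul_distM_apply (i : ℕ) (x y : V) :
    (adjM G * distM G i) y x = ({z | G.Adj y z ∧ G.dist x z = i}.ncard : ℝ) := by
  rw [← sum_ite_mul_ite, Matrix.mul_apply]
  refine Finset.sum_congr rfl fun z _ => ?_
  simp only [adjM_apply, distM_apply, G.dist_comm (v := x)]
  congr

/-- These counts are the entries of A times a distance matrix, a combination of matrices whose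
entries depend only on the distance. -/
theorem exists_ncard_adj_dist [Nonempty V] (h : IsPolarUnital G I q) (hq : 2 < q) :
    ∃ n : ℕ → ℕ → ℕ, ∀ i x y, {z | G.Adj y z ∧ G.dist x z = i}.ncard = n i (G.dist x y) := by
  have h1 : ∀ i x y x' y', G.dist x y = G.dist x' y' →
      {z | G.Adj y z ∧ G.dist x z = i}.ncard = {z | G.Adj y' z ∧ G.dist x' z = i}.ncard := by
    intro i x y x' y' hd
    obtain ⟨a, b, c, d, h2⟩ := h.exists_adjM_mul_distM hq i
    rw [← Nat.cast_inj (R := ℝ), ← adjM_mul_distM_apply, ← adjM_mul_distM_apply, h2]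
    simp [distM_apply, G.dist_comm (u := y), G.dist_comm (u := y'), hd]
  classical
  -- The count is read off at a chosen pair at distance d; the value 0 is used for distances that do
  -- not occur.
  refine ⟨fun i d => if hd : ∃ x y, G.dist x y = d then
    {z | G.Adj hd.choose_spec.choose z ∧ G.dist hd.choose z = i}.ncard else 0, fun i x y => ?_⟩
  have hd : ∃ x' y', G.dist x' y' = G.dist x y := ⟨x, y, rfl⟩
  simp only [dif_pos hd]
  exact h1 i _ _ _ _ hd.choose_spec.choose_spec.symm

theorem isDistanceRegular [Nonempty V] (h : IsPolarUnital G I q) (hq : 2 < q) :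
    G.IsDistanceRegular := by
  obtain ⟨n, hn⟩ := h.exists_ncard_adj_dist hq
  -- The case i = 0 is separate because the truncated i - 1 would be 0, whereas no vertex has
  -- distance one less than 0.
  refine ⟨h.connected hq, fun i => n i i, fun i => n (i + 1) i,
    fun i => if i = 0 then 0 else n (i - 1) i, fun x y => ⟨hn _ x y, hn _ x y, ?_⟩⟩
  by_cases h0 : G.dist x y = 0
  · simp [h0]
  · simp only [if_neg h0]
    rw [← hn]
    congr 1
    ext z
    simp only [Set.mem_ofPred_eq]
    refine and_congr_right fun _ => ?_
    omega

end IsPolarUnital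

/-! ### Eigenvalues, traces and the spectrum. -/

namespace Matrix.IsHermitian

variable {n : Type*} [Fintype n] [DecidableEq n] {A : Matrix n n ℝ}

theorem trace_pow_eq_sum_eigenvalues (hA : A.IsHermitian) (j : ℕ) :
    (A ^ j).trace = ∑ i, hA.eigenvalues i ^ j := by
  conv_lhs => rw [hA.spectral_theorem, ← map_pow, Unitary.conjStarAlgAut_apply, trace_mul_comm,
    ← mul_assoc, Unitary.coe_star_mul_self, one_mul, diagonal_pow, trace_diagonal]
  simp

theorem eval_eigenvalues_eq_zero (hA : A.IsHermitian) {p : Polynomial ℝ}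
    (hp : Polynomial.aeval A p = 0) (i : n) : p.eval (hA.eigenvalues i) = 0 := by
  have h1 : Module.End.HasEigenvalue (Matrix.toLin' A) (hA.eigenvalues i) :=
    Module.End.hasEigenvalue_iff_mem_spectrum.2 <| by
      rw [Matrix.spectrum_toLin']
      exact hA.eigenvalues_mem_spectrum_real i
  obtain ⟨v, hv⟩ := h1.exists_hasEigenvector
  have h2 := Module.End.aeval_apply_of_hasEigenvector (p := p) hv
  have h3 : Polynomial.aeval (Matrix.toLin' A) p = 0 := by
    have := Polynomial.aeval_algHom_apply (Matrix.toLinAlgEquiv' (R := ℝ) (n := n)) A p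
    rw [hp, map_zero] at this
    exact this
  rw [h3, LinearMap.zero_apply] at h2
  exact (smul_eq_zero.1 h2.symm).resolve_right hv.2

end Matrix.IsHermitian

/-- The values need not be distinct, so the multiplicities are determined only later, by the trace
equations. -/
theorem Multiset.exists_eq_replicate_of_forall {α : Type*} {a b c d : α} (m : Multiset α)
    (h : ∀ x ∈ m, x = a ∨ x = b ∨ x = c ∨ x = d) :
    ∃ i j k l : ℕ, m = replicate i a + replicate j b + replicate k c + replicate l d := by
  induction m using Multiset.induction with
  | empty => exact ⟨0, 0, 0, 0, by simp⟩
  | cons x m ih =>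
    obtain ⟨i, j, k, l, rfl⟩ := ih fun y hy => h y (mem_cons_of_mem hy)
    rcases h x (mem_cons_self _ _) with rfl | rfl | rfl | rfl
    · exact ⟨i + 1, j, k, l, by simp [replicate_succ]⟩
    · exact ⟨i, j + 1, k, l, by simp [replicate_succ]⟩
    · exact ⟨i, j, k + 1, l, by simp [replicate_succ]⟩
    · exact ⟨i, j, k, l + 1, by simp [replicate_succ]⟩

namespace IsPolarUnital

set_option linter.unusedSectionVars false

open scoped Classical

variable {V U : Type*} [Fintype V] [Fintype U] {G : SimpleGraph V} {I : V → U → Prop} {q : ℕ}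

theorem adjM_isHermitian (G : SimpleGraph V) : (adjM G).IsHermitian := by
  rw [Matrix.IsHermitian, conjTranspose_eq_transpose_of_trivial, transpose_adjM]

theorem adjM_annihilated (h : IsPolarUnital G I q) :
    (adjM G - ((q : ℝ) ^ 2 - q) • 1) * ((adjM G + 1) * (adjM G * adjM G - (q : ℝ) ^ 2 • 1)) = 0 := by
  have h0 := h.adjM_mul_ones V
  -- Since J absorbs A with factor q² - q, it suffices that this product is a multiple of J.
  have h1 : (adjM G + 1) * (adjM G * adjM G - (q : ℝ) ^ 2 • 1) =
      ((q : ℝ) ^ 2 - 2 * q) • onesMatrix V V := by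
    rw [h.adjM_mul_self, Matrix.add_mul, Matrix.one_mul, Matrix.mul_sub, Matrix.mul_sub,
      Matrix.mul_add, h.adjM_mul_childM, h0]
    simp only [Matrix.mul_smul, Matrix.mul_one]
    module
  rw [h1, Matrix.mul_smul, Matrix.sub_mul, h0, Matrix.smul_mul, Matrix.one_mul, sub_self, smul_zero]

theorem eigenvalue_cases (h : IsPolarUnital G I q) (i : V) :
    (adjM_isHermitian G).eigenvalues i = q * (q - 1) ∨ (adjM_isHermitian G).eigenvalues i = q ∨
    (adjM_isHermitian G).eigenvalues i = -1 ∨ (adjM_isHermitian G).eigenvalues i = -q := by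
  set e := (adjM_isHermitian G).eigenvalues i with he
  have h1 : Polynomial.aeval (adjM G) ((Polynomial.X - Polynomial.C ((q : ℝ) ^ 2 - q)) *
      ((Polynomial.X + 1) * (Polynomial.X * Polynomial.X - Polynomial.C ((q : ℝ) ^ 2)))) = 0 := by
    rw [← h.adjM_annihilated]
    simp only [map_mul, map_sub, map_add, map_one, Polynomial.aeval_X, Polynomial.aeval_C,
      Algebra.algebraMap_eq_smul_one, sub_smul]
  have h2 := (adjM_isHermitian G).eval_eigenvalues_eq_zero h1 i
  rw [← he] at h2
  have h3 : (e - q * (q - 1)) * ((e + 1) * ((e - q) * (e + q))) = 0 := by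
    simp only [Polynomial.eval_mul, Polynomial.eval_sub, Polynomial.eval_add, Polynomial.eval_X,
      Polynomial.eval_C, Polynomial.eval_one] at h2
    linear_combination h2
  rcases mul_eq_zero.1 h3 with h3 | h3
  · exact Or.inl (sub_eq_zero.1 h3)
  rcases mul_eq_zero.1 h3 with h3 | h3
  · exact Or.inr (Or.inr (Or.inl (eq_neg_of_add_eq_zero_left h3)))
  rcases mul_eq_zero.1 h3 with h3 | h3
  · exact Or.inr (Or.inl (sub_eq_zero.1 h3))
  · exact Or.inr (Or.inr (Or.inr (eq_neg_of_add_eq_zero_left h3)))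

theorem trace_adjM_sq (h : IsPolarUnital G I q) :
    (adjM G ^ 2).trace = Fintype.card V * ((q : ℝ) ^ 2 - q) := by
  have h1 : ∀ x, (adjM G ^ 2) x x = (q : ℝ) ^ 2 - q := fun x => by
    simp [sq (adjM G), adjM_mul_adjM_apply, h.degree_real]
  simp only [Matrix.trace, Matrix.diag_apply, h1, Finset.sum_const, Finset.card_univ, nsmul_eq_mul]

/-- Each edge lies in exactly one triangle, so the closed 3-walks at a vertex are as many as its
neighbours. -/
theorem trace_adjM_cube (h : IsPolarUnital G I q) :
    (adjM G ^ 3).trace = Fintype.card V * ((q : ℝ) ^ 2 - q) := by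
  have h1 : ∀ x, (adjM G ^ 3) x x = (q : ℝ) ^ 2 - q := fun x => by
    rw [pow_succ', sq, h.adjM_mul_self, Matrix.mul_sub, Matrix.mul_add, h.adjM_mul_childM,
      h.adjM_mul_ones]
    simp [adjM_apply]
  simp only [Matrix.trace, Matrix.diag_apply, h1, Finset.sum_const, Finset.card_univ, nsmul_eq_mul]

theorem adjSpectrum_eq [Nonempty V] (h : IsPolarUnital G I q) (hq : 2 < q) :
    G.adjSpectrum = {(q : ℝ) * ((q : ℝ) - 1)} +
      Multiset.replicate ((q ^ 4 - q) / 2 - q ^ 3 + q ^ 2) (q : ℝ) +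
      Multiset.replicate (q ^ 3) (-1 : ℝ) +
      Multiset.replicate ((q ^ 4 - q) / 2 - q ^ 3 + q - 1) (-(q : ℝ)) := by
  have hA := adjM_isHermitian G
  have hspec : G.adjSpectrum = Multiset.map hA.eigenvalues Finset.univ.val := by
    change (adjM G).charpoly.roots = _
    rw [hA.roots_charpoly_eq_eigenvalues]
    rfl
  obtain ⟨n1, n2, n3, n4, hm⟩ := Multiset.exists_eq_replicate_of_forall
    (a := (q : ℝ) * (q - 1)) (b := q) (c := -1) (d := -q)
    (Multiset.map hA.eigenvalues Finset.univ.val) (fun x hx => by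
      obtain ⟨i, -, rfl⟩ := Multiset.mem_map.1 hx
      exact h.eigenvalue_cases i)
  have hpow : ∀ j : ℕ, (adjM G ^ j).trace =
      n1 * ((q : ℝ) * (q - 1)) ^ j + n2 * (q : ℝ) ^ j + n3 * (-1) ^ j + n4 * (-q) ^ j := fun j => by
    have h1 := congrArg (fun m => (Multiset.map (fun x : ℝ => x ^ j) m).sum) hm
    simp only [Multiset.map_map, Multiset.map_add, Multiset.sum_add, Multiset.map_replicate,
      Multiset.sum_replicate, nsmul_eq_mul] at h1
    rw [← h1, hA.trace_pow_eq_sum_eigenvalues]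
    rfl
  have h0 := hpow 0
  have h1 := hpow 1
  have h2 := hpow 2
  have h3 := hpow 3
  rw [h.trace_adjM_sq] at h2
  rw [h.trace_adjM_cube] at h3
  have ht : (adjM G).trace = 0 := G.trace_adjMatrix ℝ
  rw [pow_one, ht] at h1
  rw [pow_zero, Matrix.trace_one] at h0
  rw [h.card_vertices_real (by omega)] at h0 h2 h3
  have hq' : (2 : ℝ) < q := by exact_mod_cast hq
  -- The combination x³ + x² - q²x - q² = (x+1)(x²-q²) of power sums kills the other three
  -- eigenvalues. Its value at q(q-1) is the factor below, nonzero because q > 2.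
  have e1 : (n1 : ℝ) = 1 := by
    have : ((q : ℝ) ^ 2 * ((q : ℝ) ^ 2 - q + 1) * (q * (q - 2))) ≠ 0 := by
      have : (q : ℝ) ^ 2 - q + 1 ≠ 0 := by nlinarith
      have : (q : ℝ) - 2 ≠ 0 := by linarith
      positivity
    apply mul_left_cancel₀ this
    linear_combination -h3 - h2 + (q : ℝ) ^ 2 * h1 + (q : ℝ) ^ 2 * h0
  rw [e1] at h0 h1 h2 h3
  -- x² - q² kills both q and -q; below, x + q and x - q isolate the last two multiplicities.
  have e3 : (n3 : ℝ) = (q : ℝ) ^ 3 := by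
    have : (q : ℝ) ^ 2 - 1 ≠ 0 := by nlinarith
    apply mul_left_cancel₀ this
    linear_combination (q : ℝ) ^ 2 * (-h0) + h2
  rw [e3] at h0 h1 h2 h3
  have e2 : 2 * (n2 : ℝ) = (q : ℝ) ^ 4 - q - 2 * q ^ 3 + 2 * q ^ 2 := by
    have : (q : ℝ) ≠ 0 := by linarith
    apply mul_left_cancel₀ this
    linear_combination -h1 - q * h0
  have e4 : 2 * (n4 : ℝ) = (q : ℝ) ^ 4 - q - 2 * q ^ 3 + 2 * q - 2 := by
    have : (q : ℝ) ≠ 0 := by linarith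
    apply mul_left_cancel₀ this
    linear_combination h1 - q * h0
  have f1 : n1 = 1 := by exact_mod_cast e1
  have f3 : n3 = q ^ 3 := by exact_mod_cast e3
  have f2 : 2 * n2 + q + 2 * q ^ 3 = q ^ 4 + 2 * q ^ 2 := by
    have : 2 * (n2 : ℝ) + q + 2 * q ^ 3 = q ^ 4 + 2 * q ^ 2 := by linear_combination e2
    exact_mod_cast this
  have f4 : 2 * n4 + 2 * q ^ 3 + 2 = q ^ 4 + q := by
    have : 2 * (n4 : ℝ) + 2 * q ^ 3 + 2 = q ^ 4 + q := by linear_combination e4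
    exact_mod_cast this
  -- This ensures that no subtraction in the stated multiplicities is truncated.
  have hle : q + 2 * q ^ 3 ≤ q ^ 4 := by
    have : q ^ 4 = q ^ 3 * q := by ring
    nlinarith [Nat.le_self_pow (n := 3) (by norm_num) q]
  have g2 : n2 = (q ^ 4 - q) / 2 - q ^ 3 + q ^ 2 := by omega
  have g4 : n4 = (q ^ 4 - q) / 2 - q ^ 3 + q - 1 := by omega
  rw [hspec, hm, f1, f3, ← g2, ← g4, Multiset.replicate_one]

end IsPolarUnital

/-! ### Trace and norm in a field with q² elements. -/

open Projectivization

section FiniteFields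

variable {K : Type*} [Field K] [Fintype K] {q : ℕ}

theorem one_lt_of_card_eq_sq (hK : Fintype.card K = q ^ 2) : 1 < q := by
  have h1 : 1 < q ^ 2 := hK ▸ Fintype.one_lt_card
  by_contra! h2
  interval_cases q <;> simp at h1

/-- The involutory automorphism `t ↦ t ^ q` of a field with `q ^ 2` elements. -/
theorem exists_ringHom_eq_pow (hK : Fintype.card K = q ^ 2) :
    ∃ σ : K →+* K, ∀ t, σ t = t ^ q := by
  obtain ⟨p, hp⟩ := CharP.exists K
  obtain ⟨n, hpp, hn⟩ := FiniteField.card K p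
  have : Fact p.Prime := ⟨hpp⟩
  obtain ⟨m, -, rfl⟩ := (Nat.dvd_prime_pow hpp).1
    (show q ∣ p ^ (n : ℕ) by rw [← hn, hK]; exact Dvd.intro_left (q ^ 1) (by ring))
  exact ⟨iterateFrobenius K p m, fun t => iterateFrobenius_def p m t⟩

theorem pow_pow_of_card_eq_sq (hK : Fintype.card K = q ^ 2) (t : K) : (t ^ q) ^ q = t := by
  rw [← pow_mul, ← sq, ← hK, FiniteField.pow_card]

/-- If the trace vanished, t = 1 would give characteristic 2, hence t^q = t throughout and q² - 1
would divide q - 1. -/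
theorem exists_add_pow_ne_zero (hK : Fintype.card K = q ^ 2) : ∃ s : K, s + s ^ q ≠ 0 := by
  by_contra! h
  have hq := one_lt_of_card_eq_sq hK
  have h2 : (1 : K) + 1 = 0 := by simpa using h 1
  have h1 : ∀ x : Kˣ, x ^ (q - 1) = 1 := fun x => by
    rw [Units.ext_iff, Units.val_pow_eq_pow_val, Units.val_one]
    apply mul_left_cancel₀ x.ne_zero
    rw [← pow_succ', Nat.sub_add_cancel hq.le]
    linear_combination h x - (x : K) * h2
  rw [FiniteField.forall_pow_eq_one_iff K, hK] at h1
  have h3 := Nat.le_of_dvd (by omega) h1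
  have : q < q ^ 2 := lt_self_pow₀ hq (by norm_num)
  omega

/-- In the cyclic group of order (q-1)(q+1), the image of the (q+1)-st power map is the kernel of
the (q-1)-st. So c is a norm, and its fibre is a coset of the norm kernel, which has order q + 1. -/
theorem ncard_norm_fibre (hK : Fintype.card K = q ^ 2) {c : K} (hc : c ≠ 0) (hcq : c ^ q = c) :
    {t : K | t ^ (q + 1) = c}.ncard = q + 1 := by
  have hq := one_lt_of_card_eq_sq hK
  have hcard : Nat.card Kˣ = (q - 1) * (q + 1) := by
    rw [Nat.card_units, Nat.card_eq_fintype_card, hK]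
    obtain ⟨r, rfl⟩ : ∃ r, q = r + 1 := ⟨q - 1, by omega⟩
    rw [Nat.add_sub_cancel]
    have : (r + 1) ^ 2 = r * (r + 1 + 1) + 1 := by ring
    omega
  have hker := IsCyclic.card_powMonoidHom_ker Kˣ (q + 1)
  rw [hcard, Nat.gcd_eq_right (Dvd.intro_left _ rfl)] at hker
  have hrange : (powMonoidHom (q + 1) : Kˣ →* Kˣ).range = (powMonoidHom (q - 1) : Kˣ →* Kˣ).ker := by
    refine Subgroup.eq_of_le_of_card_ge ?_ (le_of_eq ?_)
    · rintro _ ⟨t, rfl⟩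
      rw [MonoidHom.mem_ker, powMonoidHom_apply, powMonoidHom_apply, ← pow_mul, mul_comm, ← hcard,
        pow_card_eq_one']
    · rw [IsCyclic.card_powMonoidHom_range, IsCyclic.card_powMonoidHom_ker, hcard,
        Nat.gcd_eq_right (Dvd.intro_left _ rfl), Nat.gcd_eq_right (Dvd.intro _ rfl),
        Nat.mul_div_cancel _ (by omega)]
  obtain ⟨t₀, ht₀⟩ : Units.mk0 c hc ∈ (powMonoidHom (q + 1) : Kˣ →* Kˣ).range := by
    rw [hrange, MonoidHom.mem_ker, powMonoidHom_apply, Units.ext_iff]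
    apply mul_left_cancel₀ hc
    simpa [← pow_succ', Nat.sub_add_cancel hq.le] using hcq
  have ht₀' : (t₀ : K) ^ (q + 1) = c := by simpa using congrArg Units.val ht₀
  have himage : {t : K | t ^ (q + 1) = c} =
      (fun s : Kˣ => (t₀ * s : K)) '' ((powMonoidHom (q + 1) : Kˣ →* Kˣ).ker : Set Kˣ) := by
    ext t
    constructor
    · intro (ht : t ^ (q + 1) = c)
      have ht0 : t ≠ 0 := by
        rintro rfl
        exact hc (by simpa using ht.symm)
      refine ⟨t₀⁻¹ * Units.mk0 t ht0, ?_, by simp⟩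
      rw [SetLike.mem_coe, MonoidHom.mem_ker, powMonoidHom_apply, Units.ext_iff]
      simp [mul_pow, ht, ht₀', hc]
    · rintro ⟨s, hs, rfl⟩
      rw [SetLike.mem_coe, MonoidHom.mem_ker, powMonoidHom_apply, Units.ext_iff] at hs
      change _ ^ _ = _
      rw [mul_pow, ht₀']
      simpa using congrArg (c * ·) hs
  rw [himage, Set.ncard_image_of_injective]
  · exact hker
  · exact fun s s' h => Units.ext (mul_left_cancel₀ t₀.ne_zero h)

end FiniteFields

/-! ### The Hermitian form, poles and polar lines. -/

section HermitianForm

variable {K : Type*} [Field K] {q : ℕ}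

theorem hermForm_add_left (x y z : Fin 3 → K) :
    hermForm q (x + y) z = hermForm q x z + hermForm q y z := by
  simp [hermForm, add_mul, Finset.sum_add_distrib]

theorem hermForm_smul_left (c : K) (x y : Fin 3 → K) :
    hermForm q (c • x) y = c * hermForm q x y := by
  simp [hermForm, Finset.mul_sum, mul_assoc]

theorem hermForm_smul_right (c : K) (x y : Fin 3 → K) :
    hermForm q x (c • y) = c ^ q * hermForm q x y := by
  simp only [hermForm, Finset.mul_sum, Pi.smul_apply, smul_eq_mul, mul_pow]
  exact Finset.sum_congr rfl fun i _ => by ring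

theorem hermForm_zero_left (y : Fin 3 → K) : hermForm q 0 y = 0 := by
  simp [hermForm]

theorem ne_zero_of_hermForm_ne_zero {x y : Fin 3 → K} (h : hermForm q x y ≠ 0) : x ≠ 0 := by
  rintro rfl
  exact h (hermForm_zero_left y)

/-- Orthogonality of points. -/
def OrthogonalPoints (q : ℕ) (P Q : ℙ K (Fin 3 → K)) : Prop := hermForm q P.rep Q.rep = 0

theorem orthogonalPoints_mk {v w : Fin 3 → K} (hv : v ≠ 0) (hw : w ≠ 0) :
    OrthogonalPoints q (mk K v hv) (mk K w hw) ↔ hermForm q v w = 0 := by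
  obtain ⟨a, ha⟩ := exists_smul_eq_mk_rep K v hv
  obtain ⟨b, hb⟩ := exists_smul_eq_mk_rep K w hw
  rw [OrthogonalPoints, ← ha, ← hb, Units.smul_def, Units.smul_def, hermForm_smul_left,
    hermForm_smul_right]
  simp

theorem orthogonalPoints_mk_left {v : Fin 3 → K} (hv : v ≠ 0) (P : ℙ K (Fin 3 → K)) :
    OrthogonalPoints q (mk K v hv) P ↔ hermForm q v P.rep = 0 := by
  rw [← orthogonalPoints_mk hv P.rep_nonzero, mk_rep]

theorem orthogonalPoints_mk_right {v : Fin 3 → K} (hv : v ≠ 0) (P : ℙ K (Fin 3 → K)) :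
    OrthogonalPoints q P (mk K v hv) ↔ hermForm q P.rep v = 0 := by
  rw [← orthogonalPoints_mk P.rep_nonzero hv, mk_rep]

/-- The pole of the line through the points spanned by `v` and `w`. -/
def poleVector (q : ℕ) (v w : Fin 3 → K) : Fin 3 → K := fun i => (v ⨯₃ w) i ^ q

theorem poleVector_ne_zero {P Q : ℙ K (Fin 3 → K)} (h : P ≠ Q) :
    poleVector q P.rep Q.rep ≠ 0 := by
  intro h0
  apply h
  rw [← P.mk_rep, ← Q.mk_rep, mk_eq_mk_iff_crossProduct_eq_zero]
  ext i
  exact eq_zero_of_pow_eq_zero (congrFun h0 i)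

variable [Fintype K]

theorem OrthogonalPoints.symm (hK : Fintype.card K = q ^ 2) {P Q : ℙ K (Fin 3 → K)}
    (h : OrthogonalPoints q P Q) : OrthogonalPoints q Q P :=
  hermForm_eq_zero_comm hK h

/-- The q-th powers in the pole undo the conjugation in the form, leaving a triple product. -/
theorem hermForm_poleVector (hK : Fintype.card K = q ^ 2) (x v w : Fin 3 → K) :
    hermForm q x (poleVector q v w) = x ⬝ᵥ v ⨯₃ w := by
  simp [hermForm, poleVector, pow_pow_of_card_eq_sq hK, dotProduct]

theorem hermForm_left_poleVector (hK : Fintype.card K = q ^ 2) (v w : Fin 3 → K) :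
    hermForm q v (poleVector q v w) = 0 := by
  rw [hermForm_poleVector hK, dot_self_cross]

theorem hermForm_right_poleVector (hK : Fintype.card K = q ^ 2) (v w : Fin 3 → K) :
    hermForm q w (poleVector q v w) = 0 := by
  rw [hermForm_poleVector hK, dot_cross_self]

theorem crossProduct_pow (hK : Fintype.card K = q ^ 2) (v w : Fin 3 → K) :
    (fun i => v i ^ q) ⨯₃ (fun i => w i ^ q) = fun i => (v ⨯₃ w) i ^ q := by
  obtain ⟨σ, hσ⟩ := exists_ringHom_eq_pow hK
  ext i
  simp_rw [← hσ]
  fin_cases i <;> simp [cross_apply]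

/-- The Binet–Cauchy identity, applied to v, w and their conjugates. -/
theorem hermForm_poleVector_self (hK : Fintype.card K = q ^ 2) (v w : Fin 3 → K) :
    hermForm q (poleVector q v w) (poleVector q v w) =
      hermForm q v v * hermForm q w w - hermForm q v w * hermForm q w v := by
  rw [hermForm_poleVector hK]
  change (fun i => (v ⨯₃ w) i ^ q) ⬝ᵥ v ⨯₃ w = _
  rw [← crossProduct_pow hK, dotProduct_comm, cross_dot_cross]
  rfl

theorem eq_of_orthogonalPoints (hK : Fintype.card K = q ^ 2) {P Q R S : ℙ K (Fin 3 → K)}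
    (h : P ≠ Q) (hPR : OrthogonalPoints q P R) (hQR : OrthogonalPoints q Q R)
    (hPS : OrthogonalPoints q P S) (hQS : OrthogonalPoints q Q S) : R = S := by
  rw [← R.mk_rep, ← S.mk_rep, mk_eq_mk_iff_crossProduct_eq_zero]
  refine (Configuration.ofField.crossProduct_eq_zero_of_dotProduct_eq_zero
    (hPR.symm hK) (hPS.symm hK) (hQR.symm hK) (hQS.symm hK)).resolve_right ?_
  rw [crossProduct_pow hK]
  exact poleVector_ne_zero h

theorem existsUnique_pole (hK : Fintype.card K = q ^ 2) {P Q : ℙ K (Fin 3 → K)} (h : P ≠ Q) :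
    ∃! R, OrthogonalPoints q P R ∧ OrthogonalPoints q Q R :=
  ⟨mk K _ (poleVector_ne_zero h),
    ⟨(orthogonalPoints_mk_right _ _).2 (hermForm_left_poleVector hK _ _),
      (orthogonalPoints_mk_right _ _).2 (hermForm_right_poleVector hK _ _)⟩,
    fun _ hS => eq_of_orthogonalPoints hK h hS.1 hS.2
      ((orthogonalPoints_mk_right _ _).2 (hermForm_left_poleVector hK _ _))
      ((orthogonalPoints_mk_right _ _).2 (hermForm_right_poleVector hK _ _))⟩

theorem pole_isotropic_iff (hK : Fintype.card K = q ^ 2) {P Q R : ℙ K (Fin 3 → K)} (h : P ≠ Q)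
    (hP : OrthogonalPoints q P R) (hQ : OrthogonalPoints q Q R) :
    OrthogonalPoints q R R ↔ hermForm q P.rep P.rep * hermForm q Q.rep Q.rep =
      hermForm q P.rep Q.rep * hermForm q Q.rep P.rep := by
  have h1 := eq_of_orthogonalPoints hK h hP hQ
    ((orthogonalPoints_mk_right (poleVector_ne_zero h) _).2 (hermForm_left_poleVector hK _ _))
    ((orthogonalPoints_mk_right _ _).2 (hermForm_right_poleVector hK _ _))
  rw [h1, orthogonalPoints_mk, hermForm_poleVector_self hK, sub_eq_zero]

/-- Otherwise the Gram determinant vanishes for all y. Polarizing on the first two coordinate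
vectors shows that t·x₀x₁^q has trace 0 for all t, with x₀x₁^q ≠ 0, so the trace would vanish on K.
-/
theorem exists_gram_ne_zero (hK : Fintype.card K = q ^ 2) {x : Fin 3 → K}
    (hx : hermForm q x x ≠ 0) :
    ∃ y, hermForm q x x * hermForm q y y - hermForm q x y * hermForm q y x ≠ 0 := by
  by_contra! h
  have hq : q ≠ 0 := (one_lt_of_card_eq_sq hK).ne_bot
  obtain ⟨s, hs⟩ := exists_add_pow_ne_zero hK
  set N := hermForm q x x with hN
  have h1 : N - x 0 * x 0 ^ q = 0 := by
    simpa [hermForm, Fin.sum_univ_three, hq] using h ![1, 0, 0]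
  have h2 : N - x 1 * x 1 ^ q = 0 := by
    simpa [hermForm, Fin.sum_univ_three, hq] using h ![0, 1, 0]
  have h3 : ∀ t : K, N * (1 + t * t ^ q) - (x 0 + x 1 * t ^ q) * (x 0 ^ q + t * x 1 ^ q) = 0 :=
    fun t => by simpa [hermForm, Fin.sum_univ_three, hq] using h ![1, t, 0]
  have h4 : x 0 * x 1 ^ q ≠ 0 := by
    intro h0
    rcases mul_eq_zero.1 h0 with h0 | h0
    · exact hx (by simpa [h0] using h1)
    · exact hx (by simpa [h0] using h2)
  obtain ⟨t, rfl⟩ : ∃ t, s = t * (x 0 * x 1 ^ q) := ⟨s / (x 0 * x 1 ^ q), (div_mul_cancel₀ s h4).symm⟩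
  apply hs
  rw [mul_pow, mul_pow, pow_pow_of_card_eq_sq hK]
  linear_combination -h3 t + h1 + t * t ^ q * h2

/-- Gram–Schmidt by poles: e is the pole of x and y, and f the pole of x and e; their norms are Gram
determinants. -/
theorem exists_orthogonal_frame (hK : Fintype.card K = q ^ 2) {x : Fin 3 → K}
    (hx : hermForm q x x ≠ 0) :
    ∃ e f : Fin 3 → K, hermForm q x e = 0 ∧ hermForm q x f = 0 ∧ hermForm q e f = 0 ∧
      hermForm q e e ≠ 0 ∧ hermForm q f f ≠ 0 := by
  obtain ⟨y, hy⟩ := exists_gram_ne_zero hK hx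
  have he := hermForm_left_poleVector hK x y
  refine ⟨poleVector q x y, poleVector q x (poleVector q x y), he,
    hermForm_left_poleVector hK _ _, hermForm_right_poleVector hK _ _, ?_, ?_⟩
  · rwa [hermForm_poleVector_self hK]
  · rw [hermForm_poleVector_self hK, he, zero_mul, sub_zero, hermForm_poleVector_self hK]
    exact mul_ne_zero hx hy

/-- The points of the line `P^⊥` of a nonisotropic point `P`. -/
theorem exists_parametrization (hK : Fintype.card K = q ^ 2) {P : ℙ K (Fin 3 → K)}
    (hP : ¬OrthogonalPoints q P P) :
    ∃ (F : ℙ K (Fin 3 → K)) (g : K → ℙ K (Fin 3 → K)) (c : K), c ≠ 0 ∧ c ^ q = c ∧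
      Function.Injective g ∧ (∀ t, g t ≠ F) ∧ ¬OrthogonalPoints q F F ∧
      (∀ t, OrthogonalPoints q (g t) (g t) ↔ t ^ (q + 1) = c) ∧
      ∀ R, OrthogonalPoints q P R ↔ R = F ∨ ∃ t, g t = R := by
  obtain ⟨e, f, hxe, hxf, hef, hee, hff⟩ := exists_orthogonal_frame hK hP
  have hfe := hermForm_eq_zero_comm hK hef
  have hf0 := ne_zero_of_hermForm_ne_zero hff
  have he0 := ne_zero_of_hermForm_ne_zero hee
  have hle : ∀ t : K, hermForm q (e + t • f) e = hermForm q e e := fun t => by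
    rw [hermForm_add_left, hermForm_smul_left, hfe, mul_zero, add_zero]
  have hlf : ∀ t : K, hermForm q (e + t • f) f = t * hermForm q f f := fun t => by
    rw [hermForm_add_left, hermForm_smul_left, hef, zero_add]
  have hg0 : ∀ t : K, e + t • f ≠ 0 := fun t =>
    ne_zero_of_hermForm_ne_zero (y := e) (by rw [hle]; exact hee)
  have hPF : OrthogonalPoints q P (mk K f hf0) := (orthogonalPoints_mk_right _ _).2 hxf
  have hPg : ∀ t, OrthogonalPoints q P (mk K _ (hg0 t)) := fun t => by
    refine OrthogonalPoints.symm hK ((orthogonalPoints_mk_left _ _).2 ?_)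
    rw [hermForm_add_left, hermForm_smul_left, hermForm_eq_zero_comm hK hxe,
      hermForm_eq_zero_comm hK hxf, mul_zero, add_zero]
  have hgF : ∀ t, mk K _ (hg0 t) ≠ mk K f hf0 := fun t h0 => by
    have h1 := (orthogonalPoints_mk hf0 he0).2 hfe
    rw [← h0, orthogonalPoints_mk, hle] at h1
    exact hee h1
  have hFF : ¬OrthogonalPoints q (mk K f hf0) (mk K f hf0) := by
    rwa [orthogonalPoints_mk]
  obtain ⟨σ, hσ⟩ := exists_ringHom_eq_pow hK
  -- The line P^⊥ consists of F = ⟨f⟩ and the points ⟨e + tf⟩, whose norm is h(e,e) + t^(q+1)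
  -- h(f,f); c is the value of t^(q+1) at which it vanishes.
  refine ⟨mk K f hf0, fun t => mk K _ (hg0 t), -hermForm q e e / hermForm q f f,
    div_ne_zero (neg_ne_zero.2 hee) hff, ?_, ?_, hgF, hFF, ?_, fun R => ⟨fun hR => ?_, ?_⟩⟩
  · rw [← hσ, map_div₀, map_neg, hσ, hσ, hermForm_pow hK, hermForm_pow hK]
  · intro t s hts
    obtain ⟨a, ha⟩ := (mk_eq_mk_iff' K _ _ _ _).1 hts
    have h1 := congrArg (hermForm q · e) ha
    have h2 := congrArg (hermForm q · f) ha
    simp only [hermForm_smul_left, hle, hlf] at h1 h2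
    obtain rfl : a = 1 := mul_right_cancel₀ hee (by rw [h1, one_mul])
    rw [one_mul] at h2
    exact (mul_right_cancel₀ hff h2).symm
  · intro t
    have h1 : hermForm q (e + t • f) (e + t • f) = hermForm q e e + t ^ (q + 1) * hermForm q f f := by
      have h2 : hermForm q e (e + t • f) = hermForm q e e := by
        rw [← hermForm_pow hK, hle, hermForm_pow hK]
      have h3 : hermForm q f (e + t • f) = t ^ q * hermForm q f f := by
        rw [← hermForm_pow hK, hlf, mul_pow, hermForm_pow hK]
      rw [hermForm_add_left, hermForm_smul_left, h2, h3]
      ring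
    rw [orthogonalPoints_mk, h1, eq_div_iff hff]
    constructor <;> intro h2 <;> linear_combination h2
  · by_cases hRF : R = mk K f hf0
    · exact Or.inl hRF
    have hPR : P ≠ R := by
      rintro rfl
      exact hP hR
    -- R is the only point orthogonal to both P and S, so it suffices to choose t with e + tf
    -- orthogonal to S; f is not orthogonal to S because R ≠ F.
    obtain ⟨S, ⟨hPS, hRS⟩, -⟩ := existsUnique_pole hK hPR
    have hPS' : P ≠ S := by
      rintro rfl
      exact hP hPS
    have hfS : hermForm q f S.rep ≠ 0 := fun h0 => hRF <|
      eq_of_orthogonalPoints hK hPS' hR (hRS.symm hK) hPF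
        (((orthogonalPoints_mk_left hf0 _).2 h0).symm hK)
    refine Or.inr ⟨-hermForm q e S.rep / hermForm q f S.rep, ?_⟩
    refine eq_of_orthogonalPoints hK hPS' (hPg _) (OrthogonalPoints.symm hK ?_) hR (hRS.symm hK)
    rw [orthogonalPoints_mk_left, hermForm_add_left, hermForm_smul_left]
    field_simp
    ring
  · rintro (rfl | ⟨t, rfl⟩)
    · exact hPF
    · exact hPg t

/-! ### The Hermitian curve as a polar unital. -/

/-- The isotropic points of the projective plane over `K`. -/
abbrev IsotropicPoint (q : ℕ) (K : Type*) [Field K] : Type _ :=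
  {P : ℙ K (Fin 3 → K) // OrthogonalPoints q P P}

theorem ncard_isotropic_orthogonal (hK : Fintype.card K = q ^ 2) (x : NonisotropicPoint q K) :
    {u : IsotropicPoint q K | OrthogonalPoints q x.1 u.1}.ncard = q + 1 := by
  obtain ⟨F, g, c, hc, hcq, hg, hgF, hF, hiso, hcov⟩ := exists_parametrization hK x.2
  rw [← ncard_norm_fibre hK hc hcq, ← Set.ncard_image_of_injective _ Subtype.val_injective,
    ← Set.ncard_image_of_injective _ hg]
  congr 1
  ext R
  constructor
  · rintro ⟨u, hu, rfl⟩
    obtain h1 | ⟨t, ht⟩ := (hcov _).1 hu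
    · exact absurd (h1 ▸ u.2) hF
    · exact ⟨t, (hiso t).1 (ht ▸ u.2), ht⟩
  · rintro ⟨t, ht, rfl⟩
    exact ⟨⟨g t, (hiso t).2 ht⟩, (hcov _).2 (Or.inr ⟨t, rfl⟩), rfl⟩

theorem ncard_nonisotropic_orthogonal (hK : Fintype.card K = q ^ 2) (x : NonisotropicPoint q K) :
    {y : NonisotropicPoint q K | OrthogonalPoints q x.1 y.1}.ncard + q = q ^ 2 := by
  obtain ⟨F, g, c, hc, hcq, hg, hgF, hF, hiso, hcov⟩ := exists_parametrization hK x.2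
  have h1 : Subtype.val '' {y : NonisotropicPoint q K | OrthogonalPoints q x.1 y.1} =
      insert F (g '' {t : K | t ^ (q + 1) = c}ᶜ) := by
    ext R
    constructor
    · rintro ⟨u, hu, rfl⟩
      obtain h1 | ⟨t, ht⟩ := (hcov _).1 hu
      · exact Or.inl h1
      · exact Or.inr ⟨t, fun h2 => u.2 (ht ▸ (hiso t).2 h2), ht⟩
    · rintro (rfl | ⟨t, ht, rfl⟩)
      · exact ⟨⟨R, hF⟩, (hcov _).2 (Or.inl rfl), rfl⟩
      · exact ⟨⟨g t, fun h2 => ht ((hiso t).1 h2)⟩, (hcov _).2 (Or.inr ⟨t, rfl⟩), rfl⟩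
  have h2 : F ∉ g '' {t : K | t ^ (q + 1) = c}ᶜ := by
    rintro ⟨t, -, ht⟩
    exact hgF t ht
  have h3 := Set.ncard_add_ncard_compl {t : K | t ^ (q + 1) = c}
  rw [ncard_norm_fibre hK hc hcq, Nat.card_eq_fintype_card, hK] at h3
  rw [← Set.ncard_image_of_injective _ Subtype.val_injective, h1, Set.ncard_insert_of_notMem h2,
    Set.ncard_image_of_injective _ hg]
  omega

/-- The isotropic and the nonisotropic points of the plane form a unital with polarity. -/
theorem isPolarUnital_unitaryNonisotropicsGraph (hK : Fintype.card K = q ^ 2) :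
    IsPolarUnital (unitaryNonisotropicsGraph (K := K) q hK)
      (fun x (u : IsotropicPoint q K) => OrthogonalPoints q x.1 u.1) q where
  block_card := ncard_isotropic_orthogonal hK
  degree := ncard_nonisotropic_orthogonal hK
  join u v huv := by
    have huv' : u.1 ≠ v.1 := fun h => huv (Subtype.ext h)
    -- Orthogonal distinct isotropic points would both be poles of their common line, contradicting
    -- uniqueness. So the Gram determinant of u and v is nonzero and their pole is a vertex.
    have h1 : ¬OrthogonalPoints q u.1 v.1 := fun h => huv' <|
      eq_of_orthogonalPoints hK huv' u.2 (h.symm hK) h v.2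
    obtain ⟨R, ⟨h2, h3⟩, h4⟩ := existsUnique_pole hK huv'
    have h5 : ¬OrthogonalPoints q R R := by
      rw [pole_isotropic_iff hK huv' h2 h3, show hermForm q u.1.rep u.1.rep = 0 from u.2, zero_mul]
      exact (mul_ne_zero h1 fun h => h1 (OrthogonalPoints.symm hK h)).symm
    exact ⟨⟨R, h5⟩, ⟨h2.symm hK, h3.symm hK⟩,
      fun y hy => Subtype.ext (h4 y.1 ⟨hy.1.symm hK, hy.2.symm hK⟩)⟩
  meet_or_common x y hxy := by
    have hxy' : x.1 ≠ y.1 := fun h => hxy (Subtype.ext h)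
    have h1 := existsUnique_pole hK hxy'
    obtain ⟨R, hR, hu⟩ := h1
    by_cases hRR : OrthogonalPoints q R R
    · exact Or.inl ⟨⟨⟨R, hRR⟩, hR, fun u h => Subtype.ext (hu u.1 h)⟩,
        fun z hz => z.2 (hu z.1 hz ▸ hRR)⟩
    · exact Or.inr ⟨⟨⟨R, hRR⟩, hR, fun z h => Subtype.ext (hu z.1 h)⟩,
        fun u h => hRR (hu u.1 h ▸ u.2)⟩
  adj_disjoint x y hxy u hu := by
    have hxy' : x.1 ≠ y.1 := fun h => hxy.ne (Subtype.ext h)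
    have h1 := (pole_isotropic_iff hK hxy' hu.1 hu.2).1 u.2
    rw [show hermForm q x.1.rep y.1.rep = 0 from hxy, zero_mul] at h1
    exact mul_ne_zero x.2 y.2 h1
  antiflag x u hxu := by
    have hne : x.1 ≠ u.1 := fun h => x.2 (h ▸ u.2)
    obtain ⟨R, ⟨h2, h3⟩, h4⟩ := existsUnique_pole hK hne
    -- As u is isotropic, the Gram determinant of x and u reduces to -h(x,u)h(u,x), which is nonzero
    -- off the block of x.
    have h5 : ¬OrthogonalPoints q R R := by
      rw [pole_isotropic_iff hK hne h2 h3, show hermForm q u.1.rep u.1.rep = 0 from u.2, mul_zero]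
      exact (mul_ne_zero hxu fun h => hxu (OrthogonalPoints.symm hK h)).symm
    exact ⟨⟨R, h5⟩, ⟨h2, h3.symm hK⟩, fun y hy => Subtype.ext (h4 y.1 ⟨hy.1, hy.2.symm hK⟩)⟩

theorem nonempty_nonisotropicPoint (hK : Fintype.card K = q ^ 2) :
    Nonempty (NonisotropicPoint q K) := by
  have hq : q ≠ 0 := (one_lt_of_card_eq_sq hK).ne_bot
  have h1 : hermForm q ![(1 : K), 0, 0] ![1, 0, 0] ≠ 0 := by
    simp [hermForm, Fin.sum_univ_three]
  have h2 := ne_zero_of_hermForm_ne_zero h1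
  exact ⟨⟨mk K _ h2, fun h => h1 ((orthogonalPoints_mk h2 h2).1 h)⟩⟩

end HermitianForm

/-! ### Independence of the choice of the field. -/

section Isomorphism

variable {K L : Type*} [Field K] [Field L] {q : ℕ}

theorem hermForm_map (φ : K ≃+* L) (v w : Fin 3 → K) :
    hermForm q (φ ∘ v) (φ ∘ w) = φ (hermForm q v w) := by
  simp [hermForm]

/-- The coordinatewise map of an isomorphism of fields. -/
def coordinateMap (φ : K ≃+* L) : (Fin 3 → K) →ₛₗ[(φ : K →+* L)] (Fin 3 → L) where
  toFun v := φ ∘ v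
  map_add' v w := by ext; simp
  map_smul' c v := by ext; simp

theorem coordinateMap_injective (φ : K ≃+* L) : Function.Injective (coordinateMap φ) :=
  fun _ _ h => φ.injective.comp_left h

theorem coordinateMap_bijective (φ : K ≃+* L) :
    Function.Bijective (Projectivization.map (coordinateMap φ) (coordinateMap_injective φ)) := by
  have := RingHomInvPair.of_ringEquiv φ
  refine ⟨map_injective (τ := (φ.symm : L →+* K)) _ _, fun P => ?_⟩
  induction P using Projectivization.ind with
  | h w hw =>
    have h1 : coordinateMap φ (φ.symm ∘ w) = w := by
      ext i
      simp [coordinateMap]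
    refine ⟨mk K (φ.symm ∘ w) fun h => hw ?_, ?_⟩
    · rw [← h1, h, map_zero]
    · simp only [map_mk, h1]

theorem orthogonalPoints_map (φ : K ≃+* L) (P Q : ℙ K (Fin 3 → K)) :
    OrthogonalPoints q (Projectivization.map (coordinateMap φ) (coordinateMap_injective φ) P)
      (Projectivization.map (coordinateMap φ) (coordinateMap_injective φ) Q) ↔
      OrthogonalPoints q P Q := by
  induction P using Projectivization.ind with
  | h v hv =>
    induction Q using Projectivization.ind with
    | h w hw =>
      rw [map_mk, map_mk, orthogonalPoints_mk, orthogonalPoints_mk]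
      exact (congrArg (· = 0) (hermForm_map φ v w)).to_iff.trans (map_eq_zero φ)

/-- An isomorphism of fields induces an isomorphism of unitary nonisotropics graphs. -/
noncomputable def unitaryNonisotropicsGraphIso [Fintype K] [Fintype L]
    (hK : Fintype.card K = q ^ 2) (hL : Fintype.card L = q ^ 2) (φ : K ≃+* L) :
    unitaryNonisotropicsGraph (K := K) q hK ≃g unitaryNonisotropicsGraph (K := L) q hL where
  toEquiv := (Equiv.ofBijective _ (coordinateMap_bijective φ)).subtypeEquiv fun P =>
    not_congr (orthogonalPoints_map φ P P).symm
  map_rel_iff' {P Q} := orthogonalPoints_map φ P.1 Q.1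

end Isomorphism

theorem mainTheorem8 (q : ℕ) (hq : IsPrimePow q) (hq2 : 2 < q) :
    ∃ (V : Type) (_ : Fintype V) (G : SimpleGraph V),
      (∀ (K : Type*) [Field K] [Fintype K] (hK : Fintype.card K = q ^ 2),
        Nonempty (G ≃g unitaryNonisotropicsGraph (K := K) q hK)) ∧
      G.IsDistanceRegular ∧ G.diam = 3 ∧
      G.IsStronglyDeza (q ^ 2 * (q ^ 2 - q + 1)) (q * (q - 1)) 1 0 ∧
      G.adjSpectrum =
        {(q : ℝ) * ((q : ℝ) - 1)} +
        Multiset.replicate ((q ^ 4 - q) / 2 - q ^ 3 + q ^ 2) (q : ℝ) +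
        Multiset.replicate (q ^ 3) (-1 : ℝ) +
        Multiset.replicate ((q ^ 4 - q) / 2 - q ^ 3 + q - 1) (-(q : ℝ)) ∧
      G.childA 0 = G.distanceGraph 3 ∧
      (G.childA 0).IsStronglyRegularWith
        (q ^ 2 * (q ^ 2 - q + 1)) ((q - 1) * (q + 1) ^ 2) (2 * q ^ 2 - 2) ((q + 1) ^ 2) := by
  -- The graph is built over one Galois field of order p^(2m); any other field of that order is
  -- isomorphic to it, hence gives an isomorphic graph.
  obtain ⟨p, m, hp, hm, rfl⟩ := (isPrimePow_nat_iff q).1 hq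
  have : Fact p.Prime := ⟨hp⟩
  let _ : Fintype (GaloisField p (m * 2)) := Fintype.ofFinite _
  have hK₀ : Fintype.card (GaloisField p (m * 2)) = (p ^ m) ^ 2 := by
    rw [← Nat.card_eq_fintype_card, GaloisField.card p _ (by omega), pow_mul]
  let _ : Fintype (NonisotropicPoint (p ^ m) (GaloisField p (m * 2))) := Fintype.ofFinite _
  let _ : Fintype (IsotropicPoint (p ^ m) (GaloisField p (m * 2))) := Fintype.ofFinite _
  have := nonempty_nonisotropicPoint hK₀
  have h := isPolarUnital_unitaryNonisotropicsGraph hK₀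
  exact ⟨_, inferInstance, unitaryNonisotropicsGraph (p ^ m) hK₀,
    fun K _ _ hK => ⟨unitaryNonisotropicsGraphIso hK₀ hK
      (FiniteField.ringEquivOfCardEq (hK₀.trans hK.symm))⟩,
    h.isDistanceRegular hq2, h.diam_eq_three hq2, h.isStronglyDeza hq2.le, h.adjSpectrum_eq hq2,
    h.childA_eq_distanceGraph hq2, h.childA_isStronglyRegularWith hq2.le⟩
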